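/- Let $\Delta=\{z\in\mathbb C:|z|<1\}$ be the open unit disc with boundary circle $b\Delta$. For a continuous $\varphi\colon b\Delta\to\mathbb C\setminus\{0\}$ let $\mathcal W(\varphi)\in\mathbb Z$ be its winding number about the origin, that is, $1/(2\pi)$ times the change of a continuous argument of $\varphi(e^{it})$ as $t$ runs from $0$ to $2\pi$. A continuous function $f\colon b\Delta\to\mathbb C$ is said to extend meromorphically through $\Delta$ if there are a finite set $A\subset\Delta$ and a continuous extension $\tilde f\colon\overline\Delta\setminus A\to\mathbb C$ of $f$ that is holomorphic on $\Delta\setminus A$ and has a pole at each point of $A$; such an $\tilde f$ is called a meromorphic extension of $f$. **Theorem 1.1.** Let $f\colon b\Delta\to\mathbb C$ be continuous. Then $f$ extends meromorphically through $\Delta$ if and only if there is an integer $N\ge 0$ such that $$\mathcal W(Pf+Q)\ge -N\quad\text{for all polynomials } P,Q \text{ (with complex coefficients) such that } Pf+Q \text{ has no zero on } b\Delta.\tag{1.1}$$ Moreover, whenever (1.1) holds for an integer $N\ge0$, every meromorphic extension of $f$ has at most $N$ poles in $\Delta$, counted with multiplicity. -/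

import Mathlib

/-- `n` is the winding number about the origin of `φ` on the unit circle: there is a continuous
argument `θ` of `t ↦ φ (e^{it})` whose change over one counterclockwise turn is `2 π n`. -/
def IsWindingNumber (φ : Circle → ℂ) (n : ℤ) : Prop :=
  ∃ θ : ℝ → ℝ, Continuous θ ∧
    (∀ t : ℝ, φ (Circle.exp t) = (‖φ (Circle.exp t)‖ : ℂ) * Complex.exp ((θ t : ℂ) * Complex.I)) ∧
    θ (2 * Real.pi) - θ 0 = 2 * Real.pi * (n : ℝ)

open Classical in
/-- The winding number about the origin of a continuous function `φ` on the unit circle without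
zeros (the value is junk for other functions). -/
noncomputable def windingNumber (φ : Circle → ℂ) : ℤ :=
  if h : ∃ n : ℤ, IsWindingNumber φ n then h.choose else 0

/-- Two continuous arguments of the same function without zeros differ by a constant. -/
theorem continuous_arg_sub_const {a b : ℝ → ℝ} (ha : Continuous a) (hb : Continuous b)
    (h : ∀ t, Complex.exp ((a t : ℂ) * Complex.I) = Complex.exp ((b t : ℂ) * Complex.I))
    (s t : ℝ) : a s - b s = a t - b t := by
  have hk : ∀ t, ∃ k : ℤ, a t - b t = k * (2 * Real.pi) := by
    intro t
    obtain ⟨k, hk⟩ := Complex.exp_eq_exp_iff_exists_int.1 (h t)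
    refine ⟨k, ?_⟩
    have := congrArg Complex.im hk
    simp at this
    linarith
  choose k hk using hk
  have hkc : Continuous k := by
    rw [Int.isClosedEmbedding_coe_real.isEmbedding.continuous_iff]
    have : ((fun n : ℤ => (n : ℝ)) ∘ k) = fun t => (a t - b t) / (2 * Real.pi) := by
      funext t
      have := Real.pi_ne_zero
      simp only [Function.comp_apply, hk t]
      field_simp
    rw [this]
    fun_prop
  rw [hk s, hk t, PreconnectedSpace.constant inferInstance hkc (x := s) (y := t)]

theorem IsWindingNumber.unique {φ : Circle → ℂ} (h0 : ∀ z, φ z ≠ 0) {m n : ℤ}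
    (hm : IsWindingNumber φ m) (hn : IsWindingNumber φ n) : m = n := by
  obtain ⟨a, ha, ha', ham⟩ := hm
  obtain ⟨b, hb, hb', hbn⟩ := hn
  have := continuous_arg_sub_const ha hb (fun t => by
    have h1 : (‖φ (Circle.exp t)‖ : ℂ) ≠ 0 := by simpa using h0 _
    exact mul_left_cancel₀ h1 ((ha' t).symm.trans (hb' t))) (2 * Real.pi) 0
  have h2 : 2 * Real.pi * (m : ℝ) = 2 * Real.pi * (n : ℝ) := by linarith
  have h3 := mul_left_cancel₀ Real.two_pi_pos.ne' h2
  exact_mod_cast h3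

theorem exists_isWindingNumber {φ : Circle → ℂ} (hφ : Continuous φ) (h0 : ∀ z, φ z ≠ 0) :
    ∃ n : ℤ, IsWindingNumber φ n := by
  have hc : Continuous fun t : ℝ => φ (Circle.exp t) := hφ.comp Circle.exp.continuous
  obtain ⟨F, ⟨-, hF⟩, -⟩ := Complex.isCoveringMapOn_exp.existsUnique_continuousMap_lifts
    ⟨_, hc⟩ (e₀ := Complex.log (φ (Circle.exp 0))) (a₀ := (0 : ℝ))
    (Complex.exp_log (h0 _)) (fun t => h0 _)
  have hF' : ∀ t, Complex.exp (F t) = φ (Circle.exp t) := fun t => congrFun hF t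
  have hper : Complex.exp (F (2 * Real.pi)) = Complex.exp (F 0) := by
    rw [hF', hF', Circle.exp_two_pi, Circle.exp_zero]
  obtain ⟨n, hn⟩ := Complex.exp_eq_exp_iff_exists_int.1 hper
  refine ⟨n, fun t => (F t).im, by fun_prop, fun t => ?_, ?_⟩
  · rw [← hF' t, Complex.norm_exp, Complex.ofReal_exp, ← Complex.exp_add, Complex.re_add_im]
  · have := congrArg Complex.im hn
    simp at this
    simp only
    linarith

/-- The winding number of a continuous function without zeros is what it should be. -/
theorem isWindingNumber_windingNumber {φ : Circle → ℂ} (hφ : Continuous φ)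
    (h0 : ∀ z, φ z ≠ 0) : IsWindingNumber φ (windingNumber φ) := by
  have h := exists_isWindingNumber hφ h0
  rw [windingNumber, dif_pos h]
  exact h.choose_spec

/-- `g`, with set of poles `A`, is a meromorphic extension of `f` through the open unit disc:
`A` is a finite subset of the open disc, `g` agrees with `f` on the circle, is continuous on the
closed disc minus `A`, holomorphic on the open disc minus `A`, and has a pole at each point
of `A`. The values of `g` on `A` and outside the closed disc are irrelevant. -/
structure IsMeromorphicExtension (f : Circle → ℂ) (A : Finset ℂ) (g : ℂ → ℂ) : Prop where
  subset_disc : ∀ a ∈ A, a ∈ Metric.ball (0 : ℂ) 1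
  eq_on_circle : ∀ z : Circle, g (z : ℂ) = f z
  continuousOn : ContinuousOn g (Metric.closedBall (0 : ℂ) 1 \ (A : Set ℂ))
  holomorphicOn : DifferentiableOn ℂ g (Metric.ball (0 : ℂ) 1 \ (A : Set ℂ))
  pole : ∀ a ∈ A, MeromorphicAt g a ∧ meromorphicOrderAt g a < 0

/-- `f` extends meromorphically through the open unit disc. -/
def ExtendsMeromorphically (f : Circle → ℂ) : Prop :=
  ∃ (A : Finset ℂ) (g : ℂ → ℂ), IsMeromorphicExtension f A g

/-- The number of poles of `g` in `A`, counted with multiplicity: the pole at `a` has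
multiplicity minus the order of `g` at `a`. -/
noncomputable def poleCount (A : Finset ℂ) (g : ℂ → ℂ) : ℤ :=
  ∑ a ∈ A, -(meromorphicOrderAt g a).untop₀

/-- The winding numbers of all the functions `P f + Q` without zeros on the circle, where `P`
and `Q` are polynomials, are at least `-N`. -/
def WindingBoundedBelow (f : Circle → ℂ) (N : ℕ) : Prop :=
  ∀ P Q : Polynomial ℂ, (∀ z : Circle, P.eval (z : ℂ) * f z + Q.eval (z : ℂ) ≠ 0) →
    -(N : ℤ) ≤ windingNumber (fun z : Circle => P.eval (z : ℂ) * f z + Q.eval (z : ℂ))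

/-! Let `p` be the monic polynomial whose roots are the poles of an extension, with multiplicity.
Then `h = p f` is the boundary function of an element of the disc algebra, and such elements, when
zero-free on the circle, have nonnegative winding number, by polynomial approximation and Rouché.
Since `p (P f + Q) = P h + Q p`, the winding number of `P f + Q` is at least minus the number of
poles (`IsMeromorphicExtension.windingBoundedBelow`).

This bound is attained. As `h` does not vanish at the roots of `p`, interpolation gives `h = exp u +
p κ` with `u` entire and `κ` in the disc algebra. If a polynomial `R` is close to `κ`, then `p (f -
R)` is close to `exp u`, which has winding number zero, so `f - R` winds exactly minus the number of
poles (`WindingBoundedBelow.poleCount_le`).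

For existence, take `P f + Q` of least winding number and put `G = 1 / (P f + Q)`. If some negative
Fourier coefficient of `G` were nonzero, Cohen's argument (`exists_isWindingNumber_neg_one`) would
give `R G + S` of winding number `-1`; multiplying by `P f + Q` contradicts minimality. So `G`
extends to some `H` in the disc algebra, by Fejér's theorem and the maximum principle, and `f = (1 -
Q H) / (P H)` (`WindingBoundedBelow.extendsMeromorphically`). -/

/-! ### Calculus of winding numbers. -/

theorem windingNumber_eq {φ : Circle → ℂ} (h0 : ∀ z, φ z ≠ 0) {n : ℤ} (h : IsWindingNumber φ n) :
    windingNumber φ = n := by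
  have he : ∃ n : ℤ, IsWindingNumber φ n := ⟨n, h⟩
  rw [windingNumber, dif_pos he]
  exact he.choose_spec.unique h0 h

theorem IsWindingNumber.mul {φ ψ : Circle → ℂ} {m n : ℤ} (hφ : IsWindingNumber φ m)
    (hψ : IsWindingNumber ψ n) : IsWindingNumber (fun z => φ z * ψ z) (m + n) := by
  obtain ⟨a, ha, ha', ham⟩ := hφ
  obtain ⟨b, hb, hb', hbn⟩ := hψ
  refine ⟨fun t => a t + b t, ha.add hb, fun t => ?_, ?_⟩
  · change φ _ * ψ _ = (‖φ _ * ψ _‖ : ℂ) * _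
    conv_lhs => rw [ha' t, hb' t]
    rw [norm_mul]
    push_cast
    rw [add_mul, Complex.exp_add]
    ring
  · push_cast
    linarith

theorem IsWindingNumber.inv {φ : Circle → ℂ} {n : ℤ} (hφ : IsWindingNumber φ n) :
    IsWindingNumber (fun z => (φ z)⁻¹) (-n) := by
  obtain ⟨a, ha, ha', ham⟩ := hφ
  refine ⟨fun t => -a t, ha.neg, fun t => ?_, ?_⟩
  · change (φ _)⁻¹ = (‖(φ _)⁻¹‖ : ℂ) * _
    conv_lhs => rw [ha' t]
    rw [norm_inv]
    push_cast
    rw [neg_mul, Complex.exp_neg, mul_inv]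
  · push_cast
    linarith

theorem isWindingNumber_exp {u : Circle → ℂ} (hu : Continuous u) :
    IsWindingNumber (fun z => Complex.exp (u z)) 0 := by
  refine ⟨fun t => (u (Circle.exp t)).im, ?_, fun t => ?_, ?_⟩
  · exact Complex.continuous_im.comp (hu.comp Circle.exp.continuous)
  · rw [Complex.norm_exp, Complex.ofReal_exp, ← Complex.exp_add, Complex.re_add_im]
  · simp [Circle.exp_two_pi, Circle.exp_zero]

/-- The principal logarithm is continuous on the right half-plane, so the function is an
exponential. -/
theorem isWindingNumber_of_re_pos {φ : Circle → ℂ} (hφ : Continuous φ) (h : ∀ z, 0 < (φ z).re) :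
    IsWindingNumber φ 0 := by
  have h1 : φ = fun z => Complex.exp (Complex.log (φ z)) := by
    funext z
    rw [Complex.exp_log]
    intro h0
    have := h z
    simp [h0] at this
  rw [h1]
  exact isWindingNumber_exp (hφ.clog fun z => Or.inl (h z))

theorem isWindingNumber_const {c : ℂ} (hc : c ≠ 0) : IsWindingNumber (fun _ => c) 0 := by
  have := isWindingNumber_exp (u := fun _ => Complex.log c) continuous_const
  simpa only [Complex.exp_log hc] using this

/-- Winding numbers are stable under small perturbations (Rouché). -/
theorem IsWindingNumber.of_norm_sub_lt {φ ψ : Circle → ℂ} {n : ℤ} (h : IsWindingNumber φ n)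
    (hφ : Continuous φ) (hψ : Continuous ψ) (hlt : ∀ z, ‖ψ z - φ z‖ < ‖φ z‖) :
    IsWindingNumber ψ n := by
  have h0 : ∀ z, φ z ≠ 0 := fun z => norm_pos_iff.1 ((norm_nonneg _).trans_lt (hlt z))
  have h1 : IsWindingNumber (fun z => ψ z / φ z) 0 := by
    refine isWindingNumber_of_re_pos (hψ.div hφ h0) fun z => ?_
    have h2 : ‖ψ z / φ z - 1‖ < 1 := by
      rw [div_sub_one (h0 z), norm_div]
      exact (div_lt_one (norm_pos_iff.2 (h0 z))).2 (hlt z)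
    have h3 := (abs_lt.1 ((Complex.abs_re_le_norm _).trans_lt h2)).1
    simp only [Complex.sub_re, Complex.one_re] at h3
    linarith
  have h2 := h.mul h1
  rw [add_zero] at h2
  convert h2 using 2 with z
  rw [mul_div_cancel₀ _ (h0 z)]

theorem isWindingNumber_coe : IsWindingNumber (fun z => (z : ℂ)) 1 :=
  ⟨id, continuous_id, fun t => by simp, by simp⟩

theorem isWindingNumber_sub_of_norm_lt {a : ℂ} (ha : ‖a‖ < 1) :
    IsWindingNumber (fun z => (z : ℂ) - a) 1 :=
  isWindingNumber_coe.of_norm_sub_lt (by fun_prop) (by fun_prop) fun z => by simpa [Circle.norm_coe] using ha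

theorem isWindingNumber_sub_of_lt_norm {a : ℂ} (ha : 1 < ‖a‖) :
    IsWindingNumber (fun z => (z : ℂ) - a) 0 :=
  (isWindingNumber_const (c := -a) (by rintro h; simp [neg_eq_zero.1 h] at ha; linarith)).of_norm_sub_lt
    (by fun_prop) (by fun_prop) fun z => by simpa [Circle.norm_coe] using ha

/-! ### Winding numbers of polynomials. -/

/-- The monic polynomial function with root multiset `s`. -/
noncomputable def rootProd (s : Multiset ℂ) (z : ℂ) : ℂ := (s.map fun a => z - a).prod

@[simp] theorem rootProd_zero (z : ℂ) : rootProd 0 z = 1 := by simp [rootProd]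

@[simp] theorem rootProd_cons (a : ℂ) (s : Multiset ℂ) (z : ℂ) :
    rootProd (a ::ₘ s) z = (z - a) * rootProd s z := by simp [rootProd]

theorem rootProd_eq_zero_iff {s : Multiset ℂ} {z : ℂ} : rootProd s z = 0 ↔ z ∈ s := by
  simp [rootProd, Multiset.prod_eq_zero_iff, sub_eq_zero]

theorem differentiable_rootProd (s : Multiset ℂ) : Differentiable ℂ (rootProd s) := by
  induction s using Multiset.induction with
  | empty => simp [funext rootProd_zero]
  | cons a s ih =>
    rw [funext (rootProd_cons a s)]
    exact (differentiable_id.sub_const a).mul ih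

theorem isWindingNumber_rootProd {s : Multiset ℂ} (hs : ∀ a ∈ s, ‖a‖ < 1) :
    IsWindingNumber (fun z => rootProd s z) s.card := by
  induction s using Multiset.induction with
  | empty => simpa using isWindingNumber_const one_ne_zero
  | cons a s ih =>
    have h1 := ih fun b hb => hs b (Multiset.mem_cons_of_mem hb)
    have h2 := (isWindingNumber_sub_of_norm_lt (hs a (Multiset.mem_cons_self a s))).mul h1
    simpa [add_comm] using h2

theorem exists_isWindingNumber_rootProd_nonneg {s : Multiset ℂ} (hs : ∀ a ∈ s, ‖a‖ ≠ 1) :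
    ∃ n : ℤ, 0 ≤ n ∧ IsWindingNumber (fun z => rootProd s z) n := by
  induction s using Multiset.induction with
  | empty => exact ⟨0, le_rfl, by simpa using isWindingNumber_const one_ne_zero⟩
  | cons a s ih =>
    obtain ⟨n, hn, h1⟩ := ih fun b hb => hs b (Multiset.mem_cons_of_mem hb)
    rcases lt_or_gt_of_ne (hs a (Multiset.mem_cons_self a s)) with ha | ha
    · exact ⟨1 + n, by omega, by simpa using (isWindingNumber_sub_of_norm_lt ha).mul h1⟩
    · exact ⟨0 + n, by omega, by simpa using (isWindingNumber_sub_of_lt_norm ha).mul h1⟩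

theorem Polynomial.exists_isWindingNumber_nonneg {P : Polynomial ℂ}
    (hP : ∀ z : Circle, P.eval (z : ℂ) ≠ 0) :
    ∃ n : ℤ, 0 ≤ n ∧ IsWindingNumber (fun z => P.eval (z : ℂ)) n := by
  have hP0 : P ≠ 0 := by
    rintro rfl
    exact hP 1 (by simp)
  obtain ⟨n, hn, h⟩ := exists_isWindingNumber_rootProd_nonneg (s := P.roots) fun a ha h1 =>
    hP ⟨a, by simpa [Submonoid.unitSphere] using h1⟩ ((Polynomial.mem_roots hP0).1 ha)
  refine ⟨0 + n, by omega, ?_⟩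
  have h2 := (isWindingNumber_const (Polynomial.leadingCoeff_ne_zero.2 hP0)).mul h
  convert h2 using 2 with z
  conv_lhs => rw [(IsAlgClosed.splits P).eq_prod_roots]
  simp [rootProd, Polynomial.eval_multiset_prod]

/-! ### Means and Fourier coefficients on the circle. -/

open Real in
/-- The mean value of a function on the unit circle. -/
noncomputable def circleMean (f : Circle → ℂ) : ℂ :=
  ((2 * π : ℝ) : ℂ)⁻¹ * ∫ t in (0 : ℝ)..2 * π, f (Circle.exp t)

theorem circleMean_intervalIntegrable {f : Circle → ℂ} (hf : Continuous f) (a b : ℝ) :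
    IntervalIntegrable (fun t => f (Circle.exp t)) MeasureTheory.volume a b :=
  (hf.comp Circle.exp.continuous).intervalIntegrable a b

theorem circleMean_const_mul (c : ℂ) (f : Circle → ℂ) :
    circleMean (fun z => c * f z) = c * circleMean f := by
  simp only [circleMean, intervalIntegral.integral_const_mul]
  ring

theorem circleMean_sub {f g : Circle → ℂ} (hf : Continuous f) (hg : Continuous g) :
    circleMean (fun z => f z - g z) = circleMean f - circleMean g := by
  simp only [circleMean]
  rw [intervalIntegral.integral_sub (circleMean_intervalIntegrable hf _ _)
    (circleMean_intervalIntegrable hg _ _), mul_sub]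

theorem circleMean_sum {ι : Type*} (s : Finset ι) {f : ι → Circle → ℂ}
    (hf : ∀ i ∈ s, Continuous (f i)) :
    circleMean (fun z => ∑ i ∈ s, f i z) = ∑ i ∈ s, circleMean (f i) := by
  simp only [circleMean]
  rw [intervalIntegral.integral_finsetSum fun i hi => circleMean_intervalIntegrable (hf i hi) _ _,
    Finset.mul_sum]

/-- Averaging against a probability density does not increase the sup norm; used for the Fejér
kernel and for the constant density. -/
theorem norm_circleMean_mul_le {f : Circle → ℂ} {F : Circle → ℝ} (hF : Continuous F)
    (hF0 : ∀ z, 0 ≤ F z) (hF1 : circleMean (fun z => F z) = 1) {C : ℝ}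
    (hC : ∀ z, ‖f z‖ ≤ C) : ‖circleMean (fun z => f z * F z)‖ ≤ C := by
  have hpi := Real.two_pi_pos
  have h1 : ∫ t in (0 : ℝ)..2 * Real.pi, F (Circle.exp t) = 2 * Real.pi := by
    rw [circleMean, intervalIntegral.integral_ofReal, ← Complex.ofReal_inv, ← Complex.ofReal_mul,
      Complex.ofReal_eq_one, inv_mul_eq_one₀ hpi.ne'] at hF1
    exact hF1.symm
  have h2 : ‖∫ t in (0 : ℝ)..2 * Real.pi, f (Circle.exp t) * F (Circle.exp t)‖ ≤
      ∫ t in (0 : ℝ)..2 * Real.pi, C * F (Circle.exp t) := by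
    refine intervalIntegral.norm_integral_le_of_norm_le hpi.le (Filter.Eventually.of_forall
      fun t _ => ?_) ?_
    · rw [norm_mul, Complex.norm_real, Real.norm_of_nonneg (hF0 _)]
      exact mul_le_mul_of_nonneg_right (hC _) (hF0 _)
    · exact ((continuous_const.mul (hF.comp Circle.exp.continuous))).intervalIntegrable _ _
  rw [intervalIntegral.integral_const_mul, h1] at h2
  rw [circleMean, norm_mul, norm_inv, Complex.norm_real, Real.norm_of_nonneg hpi.le,
    inv_mul_le_iff₀ hpi]
  linarith

theorem circleMean_one : circleMean (fun _ => 1) = 1 := by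
  have h : ((2 * Real.pi : ℝ) : ℂ) ≠ 0 := by exact_mod_cast Real.two_pi_pos.ne'
  rw [circleMean, intervalIntegral.integral_const, sub_zero, Complex.real_smul, mul_one,
    inv_mul_cancel₀ h]

theorem norm_circleMean_le {f : Circle → ℂ} {C : ℝ} (hC : ∀ z, ‖f z‖ ≤ C) :
    ‖circleMean f‖ ≤ C := by
  simpa using norm_circleMean_mul_le (F := fun _ => 1) continuous_const (fun _ => zero_le_one)
    (by simpa using circleMean_one) hC

@[fun_prop]
theorem Circle.continuous_coe_zpow (m : ℤ) : Continuous fun z : Circle => (z : ℂ) ^ m :=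
  Continuous.zpow₀ (by fun_prop) m fun z => Or.inl (Circle.coe_ne_zero z)

theorem circleMean_zpow (m : ℤ) :
    circleMean (fun z => (z : ℂ) ^ m) = if m = 0 then 1 else 0 := by
  split_ifs with hm
  · subst hm
    simpa using circleMean_one
  · have h1 : (m : ℂ) * Complex.I ≠ 0 := mul_ne_zero (by exact_mod_cast hm) Complex.I_ne_zero
    have h2 : ∀ t : ℝ, ((Circle.exp t : ℂ)) ^ m = Complex.exp ((m : ℂ) * Complex.I * t) := by
      intro t
      rw [Circle.coe_exp, ← Complex.exp_int_mul]
      ring_nf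
    simp only [circleMean, h2]
    rw [integral_exp_mul_complex h1]
    have h3 : (m : ℂ) * Complex.I * ((2 * Real.pi : ℝ) : ℂ) = m * (2 * Real.pi * Complex.I) := by
      push_cast
      ring
    rw [h3, Complex.exp_int_mul_two_pi_mul_I]
    simp

/-- The Fourier coefficients of a function on the unit circle. -/
noncomputable def circleCoeff (f : Circle → ℂ) (m : ℤ) : ℂ :=
  circleMean fun z => f z * (z : ℂ) ^ (-m)

theorem circleCoeff_zpow (l m : ℤ) :
    circleCoeff (fun z => (z : ℂ) ^ l) m = if l = m then 1 else 0 := by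
  have h : ∀ z : Circle, (z : ℂ) ^ l * (z : ℂ) ^ (-m) = (z : ℂ) ^ (l - m) := fun z => by
    rw [← zpow_add₀ (Circle.coe_ne_zero z), sub_eq_add_neg]
  simp only [circleCoeff, h, circleMean_zpow, sub_eq_zero]

/-- Density of the trigonometric polynomials. -/
theorem exists_trigPoly_norm_sub_lt {f : Circle → ℂ} (hf : Continuous f) {ε : ℝ} (hε : 0 < ε) :
    ∃ c : ℤ →₀ ℂ, ∀ z : Circle, ‖f z - c.sum fun m a => a * (z : ℂ) ^ m‖ < ε := by
  have : Fact (0 < 2 * Real.pi) := ⟨Real.two_pi_pos⟩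
  let F : C(AddCircle (2 * Real.pi), ℂ) :=
    ⟨fun x => f x.toCircle, hf.comp AddCircle.continuous_toCircle⟩
  have h1 : F ∈ (Submodule.span ℂ (Set.range <| @fourier (2 * Real.pi))).topologicalClosure := by
    rw [span_fourier_closure_eq_top]
    trivial
  obtain ⟨T, hT, hTF⟩ := Metric.mem_closure_iff.1 h1 ε hε
  obtain ⟨c, rfl⟩ := Finsupp.mem_span_range_iff_exists_finsupp.1 hT
  refine ⟨c, fun z => ?_⟩
  obtain ⟨x, rfl⟩ := Circle.exp_surjective z
  have h2 := (ContinuousMap.norm_coe_le_norm _ (x : AddCircle (2 * Real.pi))).trans_lt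
    ((dist_eq_norm _ _).symm.trans_lt hTF)
  have h3 : AddCircle.toCircle (x : AddCircle (2 * Real.pi)) = Circle.exp x := by
    rw [AddCircle.toCircle_apply_mk, div_self Real.two_pi_pos.ne', one_mul]
  simpa [Finsupp.sum, F, fourier_apply, AddCircle.toCircle_zsmul, h3, -Circle.coe_exp] using h2

/-! ### Fejér means and polynomial approximation. -/

/-- The Fejér kernel. -/
noncomputable def fejerKernel (n : ℕ) (z : Circle) : ℝ :=
  ‖∑ k ∈ Finset.range n, (z : ℂ) ^ k‖ ^ 2 / n

theorem continuous_fejerKernel (n : ℕ) : Continuous (fejerKernel n) := by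
  unfold fejerKernel
  fun_prop

theorem fejerKernel_nonneg (n : ℕ) (z : Circle) : 0 ≤ fejerKernel n z := by
  unfold fejerKernel
  positivity

theorem coe_fejerKernel (n : ℕ) (z : Circle) :
    (fejerKernel n z : ℂ) =
      (n : ℂ)⁻¹ * ∑ j ∈ Finset.range n, ∑ k ∈ Finset.range n, (z : ℂ) ^ ((j : ℤ) - k) := by
  rw [fejerKernel]
  push_cast
  rw [← Complex.mul_conj', map_sum, Finset.sum_mul_sum, div_eq_inv_mul]
  congr 1
  refine Finset.sum_congr rfl fun j _ => Finset.sum_congr rfl fun k _ => ?_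
  rw [map_pow, ← Circle.coe_inv_eq_conj, zpow_sub₀ (Circle.coe_ne_zero z), zpow_natCast,
    zpow_natCast, Circle.coe_inv, inv_pow, div_eq_mul_inv]

/-- The Fejér means of a function on the unit circle. -/
noncomputable def fejerMean (n : ℕ) (f : Circle → ℂ) (w : Circle) : ℂ :=
  circleMean fun z => f z * fejerKernel n (w / z)

theorem fejerMean_eq (n : ℕ) {f : Circle → ℂ} (hf : Continuous f) (w : Circle) :
    fejerMean n f w = (n : ℂ)⁻¹ * ∑ j ∈ Finset.range n, ∑ k ∈ Finset.range n,
      circleCoeff f ((j : ℤ) - k) * (w : ℂ) ^ ((j : ℤ) - k) := by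
  have h : ∀ z : Circle, f z * fejerKernel n (w / z) = (n : ℂ)⁻¹ * ∑ j ∈ Finset.range n,
      ∑ k ∈ Finset.range n, (w : ℂ) ^ ((j : ℤ) - k) * (f z * (z : ℂ) ^ (-((j : ℤ) - k))) := by
    intro z
    rw [coe_fejerKernel, mul_left_comm, Finset.mul_sum]
    congr 1
    refine Finset.sum_congr rfl fun j _ => ?_
    rw [Finset.mul_sum]
    refine Finset.sum_congr rfl fun k _ => ?_
    rw [Circle.coe_div, div_zpow, zpow_neg, div_eq_mul_inv]
    ring
  simp only [fejerMean, h]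
  rw [circleMean_const_mul, circleMean_sum _ fun j _ => by fun_prop]
  congr 1
  refine Finset.sum_congr rfl fun j _ => ?_
  rw [circleMean_sum _ fun k _ => by fun_prop]
  refine Finset.sum_congr rfl fun k _ => ?_
  rw [circleMean_const_mul, circleCoeff, mul_comm]

theorem circleMean_fejerKernel_div {n : ℕ} (hn : n ≠ 0) (w : Circle) :
    circleMean (fun z => (fejerKernel n (w / z) : ℂ)) = 1 := by
  have h := fejerMean_eq n (f := fun _ => 1) continuous_const w
  have h1 : ∀ m, circleCoeff (fun _ => 1) m = if 0 = m then 1 else 0 := fun m => by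
    simpa using circleCoeff_zpow 0 m
  have hn' : (n : ℂ) ≠ 0 := by exact_mod_cast hn
  simp only [fejerMean, one_mul, h1] at h
  rw [h, inv_mul_eq_one₀ hn']
  -- For the constant function only the diagonal `k = j` survives.
  have h2 : ∀ j ∈ Finset.range n, ∑ k ∈ Finset.range n,
      (if (0 : ℤ) = (j : ℤ) - k then (1 : ℂ) else 0) * (w : ℂ) ^ ((j : ℤ) - k) = 1 := by
    intro j hj
    rw [Finset.sum_eq_single j]
    · simp
    · intro k _ hk
      rw [if_neg (by omega), zero_mul]
    · exact fun h => absurd hj h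
  rw [Finset.sum_congr rfl h2]
  simp

theorem norm_fejerMean_le {n : ℕ} (hn : n ≠ 0) {f : Circle → ℂ} {C : ℝ} (hC : ∀ z, ‖f z‖ ≤ C)
    (w : Circle) : ‖fejerMean n f w‖ ≤ C :=
  norm_circleMean_mul_le (F := fun z => fejerKernel n (w / z))
    ((continuous_fejerKernel n).comp (continuous_const.div' continuous_id))
    (fun _ => fejerKernel_nonneg _ _) (circleMean_fejerKernel_div hn w) hC

/-- Each `j < n` contributes `w ^ m / n` if `j - m` also lies in `[0, n)`, and nothing otherwise. At
most `|m|` indices, collected in `B`, are lost. -/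
theorem norm_fejerMean_zpow_sub_le {n : ℕ} (hn : n ≠ 0) (m : ℤ) (w : Circle) :
    ‖fejerMean n (fun z => (z : ℂ) ^ m) w - (w : ℂ) ^ m‖ ≤ |(m : ℝ)| / n := by
  have hn' : (n : ℂ) ≠ 0 := by exact_mod_cast hn
  classical
  let B : Finset ℕ := (Finset.range n).filter fun j => ¬ (0 ≤ (j : ℤ) - m ∧ (j : ℤ) - m < n)
  have h2 : ∀ j ∈ Finset.range n, ∑ k ∈ Finset.range n,
      circleCoeff (fun z => (z : ℂ) ^ m) ((j : ℤ) - k) * (w : ℂ) ^ ((j : ℤ) - k) =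
      (w : ℂ) ^ m - if ¬ (0 ≤ (j : ℤ) - m ∧ (j : ℤ) - m < n) then (w : ℂ) ^ m else 0 := by
    intro j hj
    simp only [circleCoeff_zpow]
    by_cases h : 0 ≤ (j : ℤ) - m ∧ (j : ℤ) - m < n
    · rw [if_neg (not_not.2 h), Finset.sum_eq_single ((j : ℤ) - m).toNat]
      · rw [if_pos (by omega)]
        have : (j : ℤ) - (((j : ℤ) - m).toNat : ℕ) = m := by omega
        rw [this]
        simp
      · intro k _ hk
        rw [if_neg (by omega), zero_mul]
      · intro hk
        simp only [Finset.mem_range] at hk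
        omega
    · rw [if_pos h, sub_self]
      refine Finset.sum_eq_zero fun k hk => ?_
      simp only [Finset.mem_range] at hk
      rw [if_neg (by omega), zero_mul]
  have hB : B.card ≤ m.natAbs := by
    rcases le_total 0 m with hm | hm
    · have : B ⊆ Finset.range m.natAbs := by
        intro j hj
        simp only [B, Finset.mem_filter, Finset.mem_range] at hj ⊢
        omega
      simpa using Finset.card_le_card this
    · have : B ⊆ Finset.Ico (n - m.natAbs) n := by
        intro j hj
        simp only [B, Finset.mem_filter, Finset.mem_range, Finset.mem_Ico] at hj ⊢
        omega
      refine (Finset.card_le_card this).trans ?_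
      rw [Nat.card_Ico]
      omega
  rw [fejerMean_eq n (by fun_prop), Finset.sum_congr rfl h2, Finset.sum_sub_distrib,
    ← Finset.sum_filter]
  simp only [Finset.sum_const, Finset.card_range, nsmul_eq_mul]
  rw [mul_sub, inv_mul_cancel_left₀ hn', sub_sub_cancel_left, norm_neg, norm_mul, norm_mul,
    norm_zpow, Circle.norm_coe, one_zpow, mul_one, norm_inv, Complex.norm_natCast,
    Complex.norm_natCast, div_eq_inv_mul]
  have h3 : (m.natAbs : ℝ) = |(m : ℝ)| := by
    rw [Nat.cast_natAbs, Int.cast_abs]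
  rw [← h3]
  gcongr

/-- Fejér's theorem. -/
theorem exists_norm_fejerMean_sub_lt {f : Circle → ℂ} (hf : Continuous f) {ε : ℝ} (hε : 0 < ε) :
    ∃ n : ℕ, ∀ w, ‖fejerMean n f w - f w‖ < ε := by
  obtain ⟨c, hc⟩ := exists_trigPoly_norm_sub_lt hf (show 0 < ε / 4 by positivity)
  set T : Circle → ℂ := fun z => c.sum fun m a => a * (z : ℂ) ^ m with hT
  have hTc : Continuous T := by
    simp only [hT, Finsupp.sum]
    fun_prop
  obtain ⟨n, hn⟩ := exists_nat_gt ((∑ m ∈ c.support, ‖c m‖ * |(m : ℝ)|) / (ε / 4))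
  have hS : 0 ≤ ∑ m ∈ c.support, ‖c m‖ * |(m : ℝ)| := Finset.sum_nonneg fun _ _ => by positivity
  have hn0 : 0 < (n : ℝ) := lt_of_le_of_lt (by positivity) hn
  have hn1 : n ≠ 0 := by
    rintro rfl
    simp at hn0
  refine ⟨n, fun w => ?_⟩
  have h1 : fejerMean n f w - fejerMean n T w = fejerMean n (fun z => f z - T z) w := by
    have hk : Continuous fun z => (fejerKernel n (w / z) : ℂ) := Complex.continuous_ofReal.comp
      ((continuous_fejerKernel n).comp (continuous_const.div' continuous_id))
    simp only [fejerMean, sub_mul]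
    exact (circleMean_sub (f := fun z => f z * fejerKernel n (w / z))
      (g := fun z => T z * fejerKernel n (w / z)) (hf.mul hk) (hTc.mul hk)).symm
  have h2 := norm_fejerMean_le hn1 (fun z => (hc z).le) w
  have h3 : fejerMean n T w - T w =
      ∑ m ∈ c.support, c m * (fejerMean n (fun z => (z : ℂ) ^ m) w - (w : ℂ) ^ m) := by
    have hk : Continuous fun z => (fejerKernel n (w / z) : ℂ) := Complex.continuous_ofReal.comp
      ((continuous_fejerKernel n).comp (continuous_const.div' continuous_id))
    simp only [fejerMean, hT, Finsupp.sum, mul_sub, Finset.sum_sub_distrib, Finset.sum_mul]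
    rw [circleMean_sum _ fun m _ => by fun_prop]
    congr 1
    refine Finset.sum_congr rfl fun m _ => ?_
    rw [← circleMean_const_mul]
    simp only [mul_assoc]
  have h4 : ‖fejerMean n T w - T w‖ ≤ ε / 4 := by
    rw [h3]
    refine (norm_sum_le_of_le _ fun m _ => ?_).trans (?_ : ∑ m ∈ c.support, ‖c m‖ * |(m : ℝ)| / n ≤ _)
    · rw [norm_mul, mul_div_assoc]
      exact mul_le_mul_of_nonneg_left (norm_fejerMean_zpow_sub_le hn1 m w) (norm_nonneg _)
    · rw [← Finset.sum_div, div_le_iff₀ hn0]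
      rw [div_lt_iff₀ (by positivity)] at hn
      linarith
  have h5 : fejerMean n f w - f w =
      fejerMean n (fun z => f z - T z) w + (fejerMean n T w - T w) - (f w - T w) := by
    rw [← h1]
    ring
  rw [h5]
  calc _ ≤ ε / 4 + ε / 4 + ε / 4 :=
        (norm_sub_le _ _).trans (add_le_add ((norm_add_le _ _).trans (add_le_add h2 h4)) (hc w).le)
    _ < ε := by linarith

/-- A continuous function without negative Fourier coefficients is a uniform limit of
polynomials. -/
theorem exists_polynomial_norm_sub_lt {f : Circle → ℂ} (hf : Continuous f)
    (h : ∀ m : ℤ, m < 0 → circleCoeff f m = 0) {ε : ℝ} (hε : 0 < ε) :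
    ∃ P : Polynomial ℂ, ∀ z : Circle, ‖f z - P.eval (z : ℂ)‖ < ε := by
  obtain ⟨n, hn⟩ := exists_norm_fejerMean_sub_lt hf hε
  refine ⟨Polynomial.C (n : ℂ)⁻¹ * ∑ j ∈ Finset.range n, ∑ k ∈ Finset.range n,
    Polynomial.C (circleCoeff f ((j : ℤ) - k)) * Polynomial.X ^ (j - k), fun z => ?_⟩
  rw [norm_sub_rev]
  refine lt_of_eq_of_lt ?_ (hn z)
  rw [fejerMean_eq n hf]
  congr 2
  simp only [Polynomial.eval_mul, Polynomial.eval_C, Polynomial.eval_finsetSum,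
    Polynomial.eval_pow, Polynomial.eval_X]
  congr 1
  refine Finset.sum_congr rfl fun j _ => Finset.sum_congr rfl fun k _ => ?_
  -- The exponent `j - k` is truncated, but where truncation matters the Fourier coefficient is
  -- zero.
  rcases lt_or_ge j k with hjk | hjk
  · rw [h _ (by omega), zero_mul, zero_mul]
  · rw [← zpow_natCast, Nat.cast_sub hjk]

/-! ### Cohen's argument. -/

/-- Conjugation on the circle inverts `z`, so it turns a negative power into a positive one without
changing the real part. The factor `z` is split off because it is later divided out. -/
theorem exists_polynomial_re_mul_eq (c : ℂ) {m : ℤ} (hm : m ≠ 0) :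
    ∃ R : Polynomial ℂ, ∀ z : Circle, (c * (z : ℂ) ^ m).re = ((z : ℂ) * R.eval (z : ℂ)).re := by
  obtain ⟨n, rfl | rfl⟩ : ∃ n : ℕ, m = (n + 1 : ℕ) ∨ m = -(n + 1 : ℕ) :=
    ⟨m.natAbs - 1, by omega⟩
  · refine ⟨Polynomial.C c * Polynomial.X ^ n, fun z => ?_⟩
    rw [zpow_natCast]
    simp only [Polynomial.eval_mul, Polynomial.eval_C, Polynomial.eval_pow, Polynomial.eval_X]
    ring_nf
  · refine ⟨Polynomial.C (starRingEnd ℂ c) * Polynomial.X ^ n, fun z => ?_⟩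
    rw [← Complex.conj_re, map_mul, map_zpow₀, ← Circle.coe_inv_eq_conj, Circle.coe_inv, inv_zpow',
      neg_neg, zpow_natCast]
    simp only [Polynomial.eval_mul, Polynomial.eval_C, Polynomial.eval_pow, Polynomial.eval_X]
    ring_nf

/-- Cohen's argument from his proof of Wermer's maximality theorem. -/
theorem exists_isWindingNumber_neg_one {f : Circle → ℂ} (hf : Continuous f) {m : ℤ} (hm : m < 0)
    (h : circleCoeff f m ≠ 0) :
    ∃ P Q : Polynomial ℂ, (∀ z : Circle, P.eval (z : ℂ) * f z + Q.eval (z : ℂ) ≠ 0) ∧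
      IsWindingNumber (fun z : Circle => P.eval (z : ℂ) * f z + Q.eval (z : ℂ)) (-1) := by
  obtain ⟨n, rfl⟩ : ∃ n : ℕ, m = -(n + 1 : ℕ) := ⟨m.natAbs - 1, by omega⟩
  set a := circleCoeff f (-(n + 1 : ℕ)) with ha
  -- The twist moves the coefficient of index `-(n + 1)` to index zero and normalises it to `1`.
  set g : Circle → ℂ := fun z => a⁻¹ * (f z * (z : ℂ) ^ (n + 1)) with hg
  have hgc : Continuous g := by fun_prop
  have hg1 : circleMean g = 1 := by
    rw [hg, circleMean_const_mul, inv_mul_eq_one₀ h, ha, circleCoeff]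
    simp only [neg_neg, zpow_natCast]
  -- The error `1 / 3` is spent twice, on approximating `g` and on comparing `c 0` with the mean
  -- `1`; a real part above `1 / 3` remains.
  obtain ⟨c, hc⟩ := exists_trigPoly_norm_sub_lt hgc (show (0 : ℝ) < 1 / 3 by norm_num)
  have hc0 : ‖1 - c 0‖ ≤ 1 / 3 := by
    have h1 : circleMean (fun z => c.sum fun m a => a * (z : ℂ) ^ m) = c 0 := by
      simp only [Finsupp.sum]
      rw [circleMean_sum _ fun m _ => by fun_prop]
      simp only [circleMean_const_mul, circleMean_zpow]
      simp [eq_comm]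
    have h2 := norm_circleMean_le fun z => (hc z).le
    rwa [circleMean_sub hgc (by simp only [Finsupp.sum]; fun_prop), hg1, h1] at h2
  have hR : ∃ R : Polynomial ℂ, ∀ z : Circle, (c.sum fun m a => a * (z : ℂ) ^ m).re =
      (c 0).re + ((z : ℂ) * R.eval (z : ℂ)).re := by
    choose! R hR using fun (m : ℤ) (hm : m ≠ 0) => exists_polynomial_re_mul_eq (c m) hm
    refine ⟨∑ m ∈ c.support.erase 0, R m, fun z => ?_⟩
    have h1 : (c.sum fun m a => a * (z : ℂ) ^ m) =
        c 0 * (z : ℂ) ^ (0 : ℤ) + ∑ m ∈ c.support.erase 0, c m * (z : ℂ) ^ m := by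
      rw [Finsupp.sum]
      by_cases h0 : (0 : ℤ) ∈ c.support
      · rw [Finset.add_sum_erase _ (fun m => c m * (z : ℂ) ^ m) h0]
      · rw [Finset.erase_eq_of_notMem h0, Finsupp.notMem_support_iff.1 h0]
        simp
    rw [h1, Polynomial.eval_finsetSum, Finset.mul_sum, Complex.add_re, Complex.re_sum,
      Complex.re_sum, zpow_zero, mul_one]
    congr 1
    exact Finset.sum_congr rfl fun m hm => hR m (Finset.ne_of_mem_erase hm) z
  obtain ⟨R, hR⟩ := hR
  have hpos : ∀ z : Circle, 0 < (g z - (z : ℂ) * R.eval (z : ℂ)).re := by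
    intro z
    have h1 := (Complex.abs_re_le_norm _).trans_lt (hc z)
    have h2 := (Complex.abs_re_le_norm _).trans hc0
    rw [Complex.sub_re, hR z] at h1
    rw [Complex.sub_re, Complex.one_re] at h2
    rw [Complex.sub_re]
    linarith [(abs_lt.1 h1).1, (abs_le.1 h2).2]
  have hw := isWindingNumber_coe.inv.mul (isWindingNumber_of_re_pos
    (φ := fun z => g z - (z : ℂ) * R.eval (z : ℂ)) (by fun_prop) hpos)
  have heq : ∀ z : Circle, (Polynomial.C a⁻¹ * Polynomial.X ^ n).eval (z : ℂ) * f z +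
      (-R).eval (z : ℂ) = (z : ℂ)⁻¹ * (g z - (z : ℂ) * R.eval (z : ℂ)) := by
    intro z
    have hz := Circle.coe_ne_zero z
    simp only [hg, Polynomial.eval_mul, Polynomial.eval_C, Polynomial.eval_pow, Polynomial.eval_X,
      Polynomial.eval_neg]
    rw [pow_succ]
    field_simp
    ring
  refine ⟨Polynomial.C a⁻¹ * Polynomial.X ^ n, -R, fun z h0 => ?_, ?_⟩
  · rw [heq] at h0
    have h1 := hpos z
    rcases mul_eq_zero.1 h0 with h2 | h2
    · exact inv_ne_zero (Circle.coe_ne_zero z) h2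
    · rw [h2] at h1
      simp at h1
  · simpa only [heq, add_zero] using hw

/-! ### The disc algebra. -/

open Metric

theorem DiffContOnCl.continuous_circle {h : ℂ → ℂ} (hh : DiffContOnCl ℂ h (ball 0 1)) :
    Continuous fun z : Circle => h z :=
  hh.continuousOn_ball.comp_continuous (by fun_prop) fun z => by simp [Circle.norm_coe]

/-- The negative Fourier coefficients of a function in the disc algebra vanish. -/
theorem DiffContOnCl.circleCoeff_eq_zero {h : ℂ → ℂ} (hh : DiffContOnCl ℂ h (ball 0 1)) {m : ℤ}
    (hm : m < 0) : circleCoeff (fun z => h z) m = 0 := by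
  obtain ⟨n, rfl⟩ : ∃ n : ℕ, m = -(n + 1 : ℕ) := ⟨m.natAbs - 1, by omega⟩
  -- Cauchy's theorem is applied to `z ^ n * h z`; the differential on the circle supplies one more
  -- power of `z`.
  have hd : DiffContOnCl ℂ (fun z => z ^ n * h z) (ball 0 1) :=
    (Differentiable.diffContOnCl (f := fun z : ℂ => z ^ n) (by fun_prop)).smul hh
  have h1 := Complex.circleIntegral_eq_zero_of_differentiable_on_off_countable zero_le_one
    Set.countable_empty hd.continuousOn_ball fun z hz => hd.differentiableAt isOpen_ball hz.1
  rw [circleIntegral] at h1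
  have h2 : ∀ t : ℝ, deriv (circleMap 0 1) t • (circleMap 0 1 t ^ n * h (circleMap 0 1 t)) =
      Complex.I * (h (Circle.exp t) * (Circle.exp t : ℂ) ^ (n + 1)) := by
    intro t
    simp only [deriv_circleMap, circleMap, Circle.coe_exp, smul_eq_mul]
    push_cast
    ring_nf
  simp only [h2, intervalIntegral.integral_const_mul, mul_eq_zero, Complex.I_ne_zero,
    false_or] at h1
  rw [circleCoeff, circleMean]
  simp only [neg_neg, zpow_natCast, h1, mul_zero]

theorem DiffContOnCl.exists_polynomial_norm_sub_lt {h : ℂ → ℂ} (hh : DiffContOnCl ℂ h (ball 0 1))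
    {ε : ℝ} (hε : 0 < ε) : ∃ P : Polynomial ℂ, ∀ z : Circle, ‖h z - P.eval (z : ℂ)‖ < ε :=
  _root_.exists_polynomial_norm_sub_lt hh.continuous_circle
    (fun _ hm => hh.circleCoeff_eq_zero hm) hε

theorem exists_pos_le_norm_circle {φ : Circle → ℂ} (hφ : Continuous φ) (h0 : ∀ z, φ z ≠ 0) :
    ∃ ε > 0, ∀ z, ε ≤ ‖φ z‖ := by
  obtain ⟨z, -, hz⟩ := isCompact_univ.exists_isMinOn (f := fun z => ‖φ z‖) Set.univ_nonempty
    hφ.norm.continuousOn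
  exact ⟨‖φ z‖, norm_pos_iff.2 (h0 z), fun w => hz (Set.mem_univ w)⟩

/-- A function in the disc algebra without zeros on the circle has a nonnegative winding number. -/
theorem DiffContOnCl.exists_isWindingNumber_nonneg {h : ℂ → ℂ}
    (hh : DiffContOnCl ℂ h (ball 0 1)) (h0 : ∀ z : Circle, h z ≠ 0) :
    ∃ n : ℤ, 0 ≤ n ∧ IsWindingNumber (fun z => h z) n := by
  obtain ⟨ε, hε, hle⟩ := exists_pos_le_norm_circle hh.continuous_circle h0
  obtain ⟨P, hP⟩ := hh.exists_polynomial_norm_sub_lt (half_pos hε)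
  have hlt : ∀ z : Circle, ε / 2 < ‖P.eval (z : ℂ)‖ := fun z => by
    have := norm_sub_norm_le (h z) (P.eval (z : ℂ))
    linarith [hP z, hle z]
  obtain ⟨n, hn, hw⟩ := Polynomial.exists_isWindingNumber_nonneg (P := P) fun z =>
    norm_pos_iff.1 ((half_pos hε).trans (hlt z))
  exact ⟨n, hn, hw.of_norm_sub_lt (by fun_prop) hh.continuous_circle fun z => (hP z).trans (hlt z)⟩

/-- A continuous function without negative Fourier coefficients is the boundary function of a
function in the disc algebra. -/
theorem exists_diffContOnCl_of_circleCoeff_eq_zero {f : Circle → ℂ} (hf : Continuous f)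
    (h : ∀ m : ℤ, m < 0 → circleCoeff f m = 0) :
    ∃ H : ℂ → ℂ, DiffContOnCl ℂ H (ball 0 1) ∧ ∀ z : Circle, H z = f z := by
  choose P hP using fun n : ℕ => exists_polynomial_norm_sub_lt hf h
    (show (0 : ℝ) < 1 / (n + 1) by positivity)
  -- The maximum principle carries the approximation on the circle to the whole closed disc.
  have hmax : ∀ m n : ℕ, ∀ z ∈ closedBall (0 : ℂ) 1,
      ‖(P m).eval z - (P n).eval z‖ ≤ 1 / (m + 1) + 1 / (n + 1) := by
    intro m n z hz
    refine Complex.norm_le_of_forall_mem_frontier_norm_le (U := ball (0 : ℂ) 1) isBounded_ball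
      (f := fun z => (P m).eval z - (P n).eval z)
      (Differentiable.diffContOnCl ((P m).differentiable.sub (P n).differentiable))
      (fun w hw => ?_) (by rwa [closure_ball _ one_ne_zero])
    rw [frontier_ball _ one_ne_zero, mem_sphere_zero_iff_norm] at hw
    obtain ⟨w, rfl⟩ : ∃ c : Circle, (c : ℂ) = w := ⟨⟨w, by simpa [Submonoid.unitSphere] using hw⟩, rfl⟩
    have h1 : (P m).eval (w : ℂ) - (P n).eval (w : ℂ) =
        (f w - (P n).eval (w : ℂ)) - (f w - (P m).eval (w : ℂ)) := by ring
    rw [h1, add_comm]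
    exact (norm_sub_le _ _).trans (add_le_add (hP n w).le (hP m w).le)
  have hcauchy : UniformCauchySeqOn (fun n z => (P n).eval z) Filter.atTop (closedBall (0 : ℂ) 1) := by
    rw [Metric.uniformCauchySeqOn_iff]
    intro ε hε
    obtain ⟨N, hN⟩ := exists_nat_one_div_lt (half_pos hε)
    refine ⟨N, fun m hm n hn z hz => ?_⟩
    rw [dist_eq_norm]
    have h1 : ∀ k : ℕ, N ≤ k → (1 : ℝ) / (k + 1) ≤ 1 / (N + 1) := fun k hk => by gcongr
    linarith [hmax m n z hz, h1 m hm, h1 n hn]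
  have hlim : ∀ z ∈ closedBall (0 : ℂ) 1,
      ∃ l, Filter.Tendsto (fun n => (P n).eval z) Filter.atTop (nhds l) := fun z hz =>
    cauchySeq_tendsto_of_complete (hcauchy.cauchySeq hz)
  choose! H hH using hlim
  have hu := hcauchy.tendstoUniformlyOn_of_tendsto hH
  refine ⟨H, ⟨?_, ?_⟩, fun z => ?_⟩
  · exact (hu.mono ball_subset_closedBall).tendstoLocallyUniformlyOn.differentiableOn
      (Filter.Eventually.of_forall fun n => (P n).differentiable.differentiableOn) isOpen_ball
  · rw [closure_ball _ one_ne_zero]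
    exact hu.continuousOn (Filter.Frequently.of_forall fun n => (P n).continuous.continuousOn)
  · refine tendsto_nhds_unique (hH z (by simp [Circle.norm_coe])) ?_
    rw [tendsto_iff_norm_sub_tendsto_zero]
    refine squeeze_zero (fun _ => norm_nonneg _) (fun n => ?_) tendsto_one_div_add_atTop_nhds_zero_nat
    rw [norm_sub_rev]
    exact (hP n z).le

/-- Used to divide by `z - a` within the disc algebra when the function vanishes at `a`. -/
theorem DiffContOnCl.dslope {h : ℂ → ℂ} (hh : DiffContOnCl ℂ h (ball 0 1)) {a : ℂ}
    (ha : a ∈ ball (0 : ℂ) 1) : DiffContOnCl ℂ (dslope h a) (ball 0 1) := by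
  refine ⟨(Complex.differentiableOn_dslope (isOpen_ball.mem_nhds ha)).2 hh.differentiableOn, ?_⟩
  rw [closure_ball _ one_ne_zero]
  exact (continuousOn_dslope (closedBall_mem_nhds_of_mem ha)).2
    ⟨hh.continuousOn_ball, hh.differentiableAt isOpen_ball ha⟩

/-! ### Interpolation by exponentials. -/

/-- The entire function `(exp w - 1) / w`. -/
theorem exists_differentiable_mul_eq_exp_sub_one :
    ∃ E : ℂ → ℂ, Differentiable ℂ E ∧ E 0 = 1 ∧ ∀ w, w * E w = Complex.exp w - 1 := by
  refine ⟨_root_.dslope Complex.exp 0, ?_, ?_, fun w => ?_⟩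
  · rw [← differentiableOn_univ]
    exact (Complex.differentiableOn_dslope Filter.univ_mem).2 Complex.differentiable_exp.differentiableOn
  · simp [dslope_same]
  · simpa using sub_smul_dslope Complex.exp 0 w

/-- A function `h` in the disc algebra without zeros on `s` is congruent modulo the polynomial
with root multiset `s` to an exponential. -/
theorem DiffContOnCl.exists_sub_exp_eq {h : ℂ → ℂ} (hh : DiffContOnCl ℂ h (ball 0 1))
    {s : Multiset ℂ} (hs : ∀ a ∈ s, a ∈ ball (0 : ℂ) 1) (h0 : ∀ a ∈ s, h a ≠ 0) :
    ∃ u κ : ℂ → ℂ, Differentiable ℂ u ∧ DiffContOnCl ℂ κ (ball 0 1) ∧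
      ∀ z, h z - Complex.exp (u z) = rootProd s z * κ z := by
  induction s using Multiset.induction with
  | empty =>
    exact ⟨fun _ => 0, fun z => h z - 1, differentiable_const 0, hh.sub_const 1, fun z => by simp⟩
  | cons a s ih =>
    obtain ⟨u, κ, hu, hκ, heq⟩ := ih (fun b hb => hs b (Multiset.mem_cons_of_mem hb))
      fun b hb => h0 b (Multiset.mem_cons_of_mem hb)
    have ha := hs a (Multiset.mem_cons_self a s)
    have ha0 := h0 a (Multiset.mem_cons_self a s)
    obtain ⟨E, hE, hE0, hEw⟩ := exists_differentiable_mul_eq_exp_sub_one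
    have hp := differentiable_rootProd s
    set p := rootProd s
    -- Replacing `u` by `u + c p` keeps the congruence modulo `p`; `c` is chosen to make the new
    -- quotient vanish at `a`. At a repeated root (`p a = 0`) the condition is linear in `c`;
    -- otherwise it says that the new exponential equals `h a` at `a`, and a logarithm solves it.
    obtain ⟨c, hc⟩ : ∃ c : ℂ, κ a - Complex.exp (u a) * (c * E (c * p a)) = 0 := by
      by_cases hpa : p a = 0
      · refine ⟨κ a / Complex.exp (u a), ?_⟩
        rw [hpa, mul_zero, hE0, mul_one, mul_div_cancel₀ _ (Complex.exp_ne_zero _), sub_self]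
      · refine ⟨Complex.log (h a / Complex.exp (u a)) / p a, ?_⟩
        have h1 := hEw (Complex.log (h a / Complex.exp (u a)))
        rw [Complex.exp_log (div_ne_zero ha0 (Complex.exp_ne_zero _))] at h1
        rw [div_mul_cancel₀ _ hpa]
        refine mul_left_cancel₀ hpa ?_
        have h2 : p a * (κ a - Complex.exp (u a) * (Complex.log (h a / Complex.exp (u a)) / p a *
            E (Complex.log (h a / Complex.exp (u a))))) = p a * κ a - Complex.exp (u a) *
              (Complex.log (h a / Complex.exp (u a)) * E (Complex.log (h a / Complex.exp (u a)))) := by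
          field_simp
        have h3 := Complex.exp_ne_zero (u a)
        rw [h2, h1, ← heq a]
        field_simp
        ring
    have hκ' : DiffContOnCl ℂ (fun z => κ z - Complex.exp (u z) * (c * E (c * p z))) (ball 0 1) :=
      hκ.sub (Differentiable.diffContOnCl (by fun_prop))
    refine ⟨fun z => u z + c * p z, _root_.dslope
      (fun z => κ z - Complex.exp (u z) * (c * E (c * p z))) a, by fun_prop, hκ'.dslope ha,
      fun z => ?_⟩
    have h1 := sub_smul_dslope (fun z => κ z - Complex.exp (u z) * (c * E (c * p z))) a z
    simp only [hc, sub_zero, smul_eq_mul] at h1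
    rw [rootProd_cons, mul_right_comm, h1, Complex.exp_add]
    linear_combination heq z + Complex.exp (u z) * hEw (c * p z)

/-! ### Poles and quotients of disc algebra functions. -/

/-- Multiplication by a polynomial clears the poles of a meromorphic extension. -/
theorem IsMeromorphicExtension.exists_clear_poles {f : Circle → ℂ} {A : Finset ℂ} {g : ℂ → ℂ}
    (hg : IsMeromorphicExtension f A g) :
    ∃ (s : Multiset ℂ) (h : ℂ → ℂ), (s.card : ℤ) = poleCount A g ∧ (∀ a ∈ s, a ∈ ball (0 : ℂ) 1) ∧
      DiffContOnCl ℂ h (ball 0 1) ∧ (∀ a ∈ s, h a ≠ 0) ∧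
      ∀ z : Circle, h z = rootProd s z * f z := by
  classical
  have hA : ∀ a ∈ A, ∃ (m : ℕ) (G : ℂ → ℂ), -(meromorphicOrderAt g a).untop₀ = m ∧
      AnalyticAt ℂ G a ∧ G a ≠ 0 ∧ ∀ᶠ z in nhdsWithin a {a}ᶜ, (z - a) ^ m * g z = G z := by
    intro a ha
    obtain ⟨hm, ho⟩ := hg.pole a ha
    obtain ⟨n, hn⟩ := WithTop.ne_top_iff_exists.1 ho.ne_top
    rw [← hn] at ho
    have hn0 : n < 0 := by exact_mod_cast ho
    obtain ⟨G, hG, hG0, hev⟩ := (meromorphicOrderAt_eq_int_iff hm).1 hn.symm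
    refine ⟨(-n).toNat, G, ?_, hG, hG0, ?_⟩
    · rw [← hn, WithTop.untop₀_coe]
      omega
    · filter_upwards [hev, self_mem_nhdsWithin] with z hz hza
      have h1 : z - a ≠ 0 := sub_ne_zero.2 hza
      rw [hz, smul_eq_mul, ← mul_assoc, ← zpow_natCast, ← zpow_add₀ h1]
      have : ((-n).toNat : ℤ) + n = 0 := by omega
      rw [this, zpow_zero, one_mul]
  choose! m G hmo hG hG0 hev using hA
  set s : Multiset ℂ := ∑ a ∈ A, Multiset.replicate (m a) a with hs
  have hroot : ∀ z, rootProd s z = ∏ a ∈ A, (z - a) ^ m a := by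
    intro z
    have h1 : s.map (fun a => z - a) = ∑ a ∈ A, (Multiset.replicate (m a) a).map fun a => z - a :=
      map_sum (Multiset.mapAddMonoidHom fun a => z - a) _ _
    rw [rootProd, h1, Multiset.prod_sum]
    simp
  have hmem : ∀ a ∈ s, a ∈ A := by
    intro a ha
    obtain ⟨b, hb, hab⟩ := Multiset.mem_sum.1 ha
    rwa [Multiset.eq_of_mem_replicate hab]
  -- The values of `g` at its poles are arbitrary, so there `h` takes the value prescribed by the
  -- local factor `G`.
  let h : ℂ → ℂ := fun z =>
    if z ∈ A then (∏ b ∈ A.erase z, (z - b) ^ m b) * G z z else rootProd s z * g z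
  have hcompl : ∀ z ∉ A, ∀ᶠ w in nhds z, w ∉ A := fun z hz =>
    A.finite_toSet.isClosed.isOpen_compl.mem_nhds hz
  have hat : ∀ a ∈ A, DifferentiableAt ℂ h a := by
    intro a ha
    have h1 : DifferentiableAt ℂ (fun z => (∏ b ∈ A.erase a, (z - b) ^ m b) * G a z) a :=
      DifferentiableAt.mul (by fun_prop) (hG a ha).differentiableAt
    refine h1.congr_of_eventuallyEq ?_
    have h2 : ∀ᶠ z in nhds a, z ∉ A.erase a :=
      (A.erase a).finite_toSet.isClosed.isOpen_compl.mem_nhds (by simp)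
    have h3 := eventually_nhdsWithin_iff.1 (hev a ha)
    filter_upwards [h2, h3] with z hz2 hz3
    by_cases hza : z = a
    · subst hza
      simp only [h, if_pos ha]
    · have hzA : z ∉ A := fun hzA => hz2 (Finset.mem_erase.2 ⟨hza, hzA⟩)
      simp only [h, if_neg hzA]
      rw [hroot, ← Finset.prod_erase_mul _ _ ha, mul_assoc, hz3 hza]
  refine ⟨s, h, ?_, fun a ha => hg.subset_disc a (hmem a ha), ⟨fun z hz => ?_, ?_⟩,
    fun a ha => ?_, fun z => ?_⟩
  · rw [hs, Multiset.card_sum, poleCount]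
    push_cast
    exact Finset.sum_congr rfl fun a ha => by rw [hmo a ha, Multiset.card_replicate]
  · by_cases hzA : z ∈ A
    · exact (hat z hzA).differentiableWithinAt
    · have h1 : DifferentiableAt ℂ g z := hg.holomorphicOn.differentiableAt
        ((isOpen_ball.sdiff A.finite_toSet.isClosed).mem_nhds ⟨hz, hzA⟩)
      refine (((differentiable_rootProd s z).mul h1).congr_of_eventuallyEq
        ?_).differentiableWithinAt
      filter_upwards [hcompl z hzA] with w hw
      simp only [h, if_neg hw, Pi.mul_apply]
  · rw [closure_ball _ one_ne_zero]
    intro z hz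
    by_cases hzA : z ∈ A
    · exact (hat z hzA).continuousAt.continuousWithinAt
    · have h1 : ContinuousWithinAt g (closedBall 0 1) z :=
        (hg.continuousOn z ⟨hz, hzA⟩).mono_of_mem_nhdsWithin
          (Filter.inter_mem self_mem_nhdsWithin (mem_nhdsWithin_of_mem_nhds (hcompl z hzA)))
      refine ((differentiable_rootProd s z).continuousAt.continuousWithinAt.mul
        h1).congr_of_eventuallyEq_of_mem ?_ hz
      filter_upwards [mem_nhdsWithin_of_mem_nhds (hcompl z hzA)] with w hw
      simp only [h, if_neg hw, Pi.mul_apply]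
  · have haA := hmem a ha
    simp only [h, if_pos haA]
    refine mul_ne_zero (Finset.prod_ne_zero_iff.2 fun b hb => pow_ne_zero _ ?_) (hG0 a haA)
    exact sub_ne_zero.2 (Finset.ne_of_mem_erase hb).symm
  · have hzA : (z : ℂ) ∉ A := fun hzA => by
      simpa [Circle.norm_coe] using hg.subset_disc _ hzA
    simp only [h, if_neg hzA, hg.eq_on_circle]

/-- Infinitely many zeros would accumulate in the closed disc, but not on the circle; the identity
theorem and continuity would then force zeros on the circle. -/
theorem DiffContOnCl.finite_zeros {b : ℂ → ℂ} (hb : DiffContOnCl ℂ b (ball 0 1))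
    (h0 : ∀ z : Circle, b z ≠ 0) : {z ∈ ball (0 : ℂ) 1 | b z = 0}.Finite := by
  by_contra hinf
  have h1 : IsCompact (closedBall (0 : ℂ) 1 ∩ b ⁻¹' {0}) :=
    (isCompact_closedBall (0 : ℂ) 1).of_isClosed_subset
      (hb.continuousOn_ball.preimage_isClosed_of_isClosed isClosed_closedBall isClosed_singleton)
      Set.inter_subset_left
  obtain ⟨x, ⟨hxc, hx0⟩, hx⟩ := Set.Infinite.exists_accPt_of_subset_isCompact hinf h1
    fun z hz => ⟨ball_subset_closedBall hz.1, hz.2⟩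
  have hxb : x ∈ ball (0 : ℂ) 1 := by
    rw [mem_ball_zero_iff]
    refine lt_of_le_of_ne (mem_closedBall_zero_iff.1 hxc) fun hx1 => ?_
    exact h0 ⟨x, by simpa [Submonoid.unitSphere] using hx1⟩ hx0
  have h2 : Set.EqOn b 0 (ball 0 1) :=
    (hb.differentiableOn.analyticOnNhd isOpen_ball).eqOn_zero_of_preconnected_of_frequently_eq_zero
      (convex_ball _ _).isPreconnected hxb
      ((accPt_iff_frequently_nhdsNE.1 hx).mono fun z hz => hz.2)
  have h3 : Set.EqOn b 0 (closedBall 0 1) := by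
    rw [← closure_ball _ one_ne_zero] at *
    exact h2.of_subset_closure hb.continuousOn continuousOn_const subset_closure subset_rfl
  exact h0 1 (h3 (by simp))

/-- A quotient of functions in the disc algebra whose denominator has no zero on the circle is a
meromorphic extension of its boundary function. -/
theorem extendsMeromorphically_of_eq_div {f : Circle → ℂ} {a b : ℂ → ℂ}
    (ha : DiffContOnCl ℂ a (ball 0 1)) (hb : DiffContOnCl ℂ b (ball 0 1))
    (h0 : ∀ z : Circle, b z ≠ 0) (hf : ∀ z : Circle, f z = a z / b z) :
    ExtendsMeromorphically f := by
  classical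
  have haa := ha.differentiableOn.analyticOnNhd isOpen_ball
  have hba := hb.differentiableOn.analyticOnNhd isOpen_ball
  set q : ℂ → ℂ := a / b with hq
  have hqm : MeromorphicOn q (ball 0 1) := fun z hz =>
    (haa z hz).meromorphicAt.div (hba z hz).meromorphicAt
  -- The normal form repairs the values of `a / b` at removable singularities and changes nothing
  -- outside the open disc.
  set g := toMeromorphicNFOn q (ball 0 1) with hgdef
  have hgq : ∀ z, (z ∈ ball (0 : ℂ) 1 → b z ≠ 0) → g z = q z := by
    intro z hz
    by_cases hzb : z ∈ ball (0 : ℂ) 1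
    · have h1 : AnalyticAt ℂ q z := (haa z hzb).div (hba z hzb) (hz hzb)
      rw [hgdef, toMeromorphicNFOn_eq_toMeromorphicNFAt hqm hzb,
        toMeromorphicNFAt_eq_self.2 h1.meromorphicNFAt]
    · exact toMeromorphicNFOn_eq_self_on_compl hqm hzb
  -- Zeros of `b` cancelled by zeros of `a` are not poles.
  set A := (hb.finite_zeros h0).toFinset.filter fun z => meromorphicOrderAt q z < 0 with hA
  have hAb : ∀ z ∈ A, z ∈ ball (0 : ℂ) 1 := fun z hz => by
    simp only [hA, Finset.mem_filter, Set.Finite.mem_toFinset] at hz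
    exact hz.1.1
  have hgan : ∀ z ∈ ball (0 : ℂ) 1 \ (A : Set ℂ), AnalyticAt ℂ g z := by
    rintro z ⟨hz, hzA⟩
    have h1 := meromorphicNFOn_toMeromorphicNFOn q (ball (0 : ℂ) 1) hz
    refine h1.meromorphicOrderAt_nonneg_iff_analyticAt.1 ?_
    rw [meromorphicOrderAt_toMeromorphicNFOn hqm hz]
    by_cases hbz : b z = 0
    · by_contra hneg
      refine hzA ?_
      simp only [hA, Finset.coe_filter, Set.Finite.mem_toFinset]
      exact ⟨⟨hz, hbz⟩, not_le.1 hneg⟩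
    · exact ((haa z hz).div (hba z hz) hbz).meromorphicOrderAt_nonneg
  refine ⟨A, g, hAb, fun z => ?_, fun z hz => ?_, fun z hz => ?_, fun z hz => ?_⟩
  · rw [hgq z (fun hz => by simp [Circle.norm_coe] at hz), hf z]
    rfl
  · by_cases hzb : z ∈ ball (0 : ℂ) 1
    · exact (hgan z ⟨hzb, hz.2⟩).continuousAt.continuousWithinAt
    · have hz1 : ‖z‖ = 1 := le_antisymm (mem_closedBall_zero_iff.1 hz.1)
        (not_lt.1 fun h => hzb (mem_ball_zero_iff.2 h))
      have hbz : b z ≠ 0 := h0 ⟨z, by simpa [Submonoid.unitSphere] using hz1⟩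
      have hcb := hb.continuousOn_ball z hz.1
      refine ContinuousWithinAt.mono ?_ Set.sdiff_subset
      refine ((ha.continuousOn_ball z hz.1).div hcb hbz).congr_of_eventuallyEq_of_mem ?_ hz.1
      filter_upwards [hcb.eventually_ne hbz] with w hw
      exact hgq w fun _ => hw
  · exact (hgan z hz).differentiableAt.differentiableWithinAt
  · refine ⟨(meromorphicNFOn_toMeromorphicNFOn q (ball (0 : ℂ) 1) (hAb z hz)).meromorphicAt, ?_⟩
    rw [meromorphicOrderAt_toMeromorphicNFOn hqm (hAb z hz)]
    exact (Finset.mem_filter.1 hz).2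

/-! ### The two implications and the pole count. -/

theorem exists_pos_norm_circle_le {φ : Circle → ℂ} (hφ : Continuous φ) :
    ∃ C > 0, ∀ z, ‖φ z‖ ≤ C := by
  obtain ⟨C, hC⟩ := isCompact_univ.exists_bound_of_continuousOn hφ.continuousOn
  exact ⟨max C 1, by positivity, fun z => (hC z (Set.mem_univ z)).trans (le_max_left _ _)⟩

/-- The constant term of a polynomial can be perturbed so that no zero is on the circle. -/
theorem Polynomial.exists_add_C_ne_zero (P : Polynomial ℂ) {ε : ℝ} (hε : 0 < ε) :
    ∃ δ : ℂ, ‖δ‖ < ε ∧ ∀ z : Circle, (P + Polynomial.C δ).eval (z : ℂ) ≠ 0 := by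
  -- A smooth curve in the plane has dense complement.
  have hd : Dense (Set.range fun t : ℝ => -P.eval (Complex.exp (t * Complex.I)))ᶜ := by
    refine ContDiff.dense_compl_range_of_finrank_lt_finrank ?_ (by simp)
    have h1 : ContDiff ℝ 1 fun w : ℂ => P.eval w := P.differentiable.contDiff.restrict_scalars ℝ
    have h2 : ContDiff ℝ 1 fun t : ℝ => Complex.exp (t * Complex.I) :=
      (Complex.ofRealCLM.contDiff.mul contDiff_const).cexp
    exact (h1.comp h2).neg
  obtain ⟨δ, hδ, hδε⟩ := Metric.dense_iff.1 hd 0 ε hε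
  refine ⟨δ, by simpa using hδ, fun z hz => hδε ?_⟩
  obtain ⟨t, rfl⟩ := Circle.exp_surjective z
  refine ⟨t, ?_⟩
  simp only [Polynomial.eval_add, Polynomial.eval_C, Circle.coe_exp] at hz
  linear_combination -hz

theorem IsMeromorphicExtension.windingBoundedBelow {f : Circle → ℂ} {A : Finset ℂ} {g : ℂ → ℂ}
    (hg : IsMeromorphicExtension f A g) {N : ℕ} (hN : poleCount A g ≤ N) :
    WindingBoundedBelow f N := by
  obtain ⟨s, h, hcard, hs, hh, -, heq⟩ := hg.exists_clear_poles
  intro P Q hPQ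
  have hs1 : ∀ a ∈ s, ‖a‖ < 1 := fun a ha => mem_ball_zero_iff.1 (hs a ha)
  have hp0 : ∀ z : Circle, rootProd s z ≠ 0 := fun z hz => by
    simpa [Circle.norm_coe] using hs1 _ (rootProd_eq_zero_iff.1 hz)
  have hrp := differentiable_rootProd s
  have hd : DiffContOnCl ℂ (fun z => P.eval z * h z + Q.eval z * rootProd s z) (ball 0 1) :=
    ((Differentiable.diffContOnCl P.differentiable).smul hh).add
      (Differentiable.diffContOnCl (Q.differentiable.mul hrp))
  have hmul : ∀ z : Circle, P.eval (z : ℂ) * h z + Q.eval (z : ℂ) * rootProd s z =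
      rootProd s z * (P.eval (z : ℂ) * f z + Q.eval (z : ℂ)) := fun z => by
    rw [heq]
    ring
  obtain ⟨n, hn, hw⟩ := hd.exists_isWindingNumber_nonneg fun z => by
    rw [hmul]
    exact mul_ne_zero (hp0 z) (hPQ z)
  have hw2 := (isWindingNumber_rootProd hs1).inv.mul hw
  simp only [hmul, inv_mul_cancel_left₀ (hp0 _)] at hw2
  rw [windingNumber_eq hPQ hw2]
  omega

theorem WindingBoundedBelow.poleCount_le {f : Circle → ℂ} (hf : Continuous f) {N : ℕ}
    (hN : WindingBoundedBelow f N) {A : Finset ℂ} {g : ℂ → ℂ}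
    (hg : IsMeromorphicExtension f A g) : poleCount A g ≤ N := by
  obtain ⟨s, h, hcard, hs, hh, hs0, heq⟩ := hg.exists_clear_poles
  obtain ⟨u, κ, hu, hκ, hueq⟩ := hh.exists_sub_exp_eq hs hs0
  have hs1 : ∀ a ∈ s, ‖a‖ < 1 := fun a ha => mem_ball_zero_iff.1 (hs a ha)
  have hp0 : ∀ z : Circle, rootProd s z ≠ 0 := fun z hz => by
    simpa [Circle.norm_coe] using hs1 _ (rootProd_eq_zero_iff.1 hz)
  have huc : Continuous fun z : Circle => u z := hu.continuous.comp (by fun_prop)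
  have hpc : Continuous fun z : Circle => rootProd s z :=
    (differentiable_rootProd s).continuous.comp (by fun_prop)
  obtain ⟨ε, hε, hεle⟩ := exists_pos_le_norm_circle huc.cexp fun _ => Complex.exp_ne_zero _
  obtain ⟨C, hC, hCle⟩ := exists_pos_norm_circle_le hpc
  obtain ⟨R, hR⟩ := hκ.exists_polynomial_norm_sub_lt (div_pos hε hC)
  have hlt : ∀ z : Circle, ‖rootProd s z * (f z - R.eval (z : ℂ)) - Complex.exp (u z)‖ <
      ‖Complex.exp (u z)‖ := by
    intro z
    have h1 : rootProd s z * (f z - R.eval (z : ℂ)) - Complex.exp (u z) =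
        rootProd s z * (κ z - R.eval (z : ℂ)) := by
      linear_combination hueq z - heq z
    rw [h1, norm_mul]
    calc _ ≤ C * ‖κ z - R.eval (z : ℂ)‖ := mul_le_mul_of_nonneg_right (hCle z) (norm_nonneg _)
      _ < C * (ε / C) := mul_lt_mul_of_pos_left (hR z) hC
      _ = ε := mul_div_cancel₀ _ hC.ne'
      _ ≤ _ := hεle z
  have hw := (isWindingNumber_exp huc).of_norm_sub_lt huc.cexp
    (ψ := fun z => rootProd s z * (f z - R.eval (z : ℂ))) (by fun_prop) hlt
  have hw2 := (isWindingNumber_rootProd hs1).inv.mul hw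
  simp only [inv_mul_cancel_left₀ (hp0 _), sub_eq_add_neg] at hw2
  have hform : ∀ z : Circle, (1 : Polynomial ℂ).eval (z : ℂ) * f z + (-R).eval (z : ℂ) =
      f z + -R.eval (z : ℂ) := fun z => by simp
  have hne : ∀ z : Circle, (1 : Polynomial ℂ).eval (z : ℂ) * f z + (-R).eval (z : ℂ) ≠ 0 := by
    intro z h0
    have h1 := hlt z
    rw [hform, ← sub_eq_add_neg] at h0
    rw [h0] at h1
    simp at h1
  have h2 := hN 1 (-R) hne
  rw [windingNumber_eq hne (n := -(s.card : ℤ) + 0) (by simpa only [hform] using hw2)] at h2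
  omega

theorem WindingBoundedBelow.extendsMeromorphically {f : Circle → ℂ} (hf : Continuous f) {N : ℕ}
    (hN : WindingBoundedBelow f N) : ExtendsMeromorphically f := by
  obtain ⟨n, ⟨P₀, Q, hne₀, hn₀⟩, hmin⟩ := Int.exists_least_of_bdd
    (P := fun n => ∃ P Q : Polynomial ℂ,
      (∀ z : Circle, P.eval (z : ℂ) * f z + Q.eval (z : ℂ) ≠ 0) ∧
      IsWindingNumber (fun z : Circle => P.eval (z : ℂ) * f z + Q.eval (z : ℂ)) n)
    ⟨-N, by
      rintro n ⟨P, Q, hne, hn⟩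
      have := hN P Q hne
      rwa [windingNumber_eq hne hn] at this⟩
    ⟨0, 0, 1, fun z => by simp, by simpa using isWindingNumber_const one_ne_zero⟩
  -- `P` will appear in the denominator of `f`, so it is perturbed off its zeros on the circle;
  -- Rouché preserves the minimal winding number.
  obtain ⟨P, hP, hne, hn⟩ : ∃ P : Polynomial ℂ, (∀ z : Circle, P.eval (z : ℂ) ≠ 0) ∧
      (∀ z : Circle, P.eval (z : ℂ) * f z + Q.eval (z : ℂ) ≠ 0) ∧
      IsWindingNumber (fun z : Circle => P.eval (z : ℂ) * f z + Q.eval (z : ℂ)) n := by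
    obtain ⟨ε, hε, hεle⟩ := exists_pos_le_norm_circle
      (φ := fun z : Circle => P₀.eval (z : ℂ) * f z + Q.eval (z : ℂ)) (by fun_prop) hne₀
    obtain ⟨C, hC, hCle⟩ := exists_pos_norm_circle_le hf
    obtain ⟨δ, hδ, hP⟩ := P₀.exists_add_C_ne_zero (div_pos hε hC)
    have hlt : ∀ z : Circle, ‖(P₀ + Polynomial.C δ).eval (z : ℂ) * f z + Q.eval (z : ℂ) -
        (P₀.eval (z : ℂ) * f z + Q.eval (z : ℂ))‖ < ‖P₀.eval (z : ℂ) * f z + Q.eval (z : ℂ)‖ := by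
      intro z
      have h1 : (P₀ + Polynomial.C δ).eval (z : ℂ) * f z + Q.eval (z : ℂ) -
          (P₀.eval (z : ℂ) * f z + Q.eval (z : ℂ)) = δ * f z := by
        simp only [Polynomial.eval_add, Polynomial.eval_C]
        ring
      rw [h1, norm_mul]
      calc _ ≤ ‖δ‖ * C := mul_le_mul_of_nonneg_left (hCle z) (norm_nonneg _)
        _ < ε / C * C := mul_lt_mul_of_pos_right hδ hC
        _ = ε := div_mul_cancel₀ _ hC.ne'
        _ ≤ _ := hεle z
    refine ⟨P₀ + Polynomial.C δ, hP, fun z h0 => ?_,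
      hn₀.of_norm_sub_lt (by fun_prop) (by fun_prop) hlt⟩
    have h1 := hlt z
    rw [h0, zero_sub, norm_neg] at h1
    exact lt_irrefl _ h1
  set G : Circle → ℂ := fun z => (P.eval (z : ℂ) * f z + Q.eval (z : ℂ))⁻¹ with hG
  have hGc : Continuous G := Continuous.inv₀ (by fun_prop) hne
  have hcoeff : ∀ m : ℤ, m < 0 → circleCoeff G m = 0 := by
    intro m hm
    by_contra hGm
    obtain ⟨R, S, hRS, hw⟩ := exists_isWindingNumber_neg_one hGc hm hGm
    -- Since `G` inverts `P f + Q`, the product is again a polynomial combination of `f` and `1`,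
    -- now with winding number `n - 1`.
    have heq : ∀ z : Circle, (S * P).eval (z : ℂ) * f z + (R + S * Q).eval (z : ℂ) =
        (R.eval (z : ℂ) * G z + S.eval (z : ℂ)) * (P.eval (z : ℂ) * f z + Q.eval (z : ℂ)) := by
      intro z
      simp only [hG, Polynomial.eval_mul, Polynomial.eval_add]
      field_simp [hne z]
      ring
    have h1 := hmin _ ⟨S * P, R + S * Q, fun z => by
      rw [heq]
      exact mul_ne_zero (hRS z) (hne z), by
      simpa only [heq] using hw.mul hn⟩
    omega
  obtain ⟨H, hH, hHG⟩ := exists_diffContOnCl_of_circleCoeff_eq_zero hGc hcoeff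
  have hH0 : ∀ z : Circle, H z ≠ 0 := fun z => by
    rw [hHG]
    exact inv_ne_zero (hne z)
  refine extendsMeromorphically_of_eq_div (a := fun z => 1 - Q.eval z * H z)
    (b := fun z => P.eval z * H z)
    (diffContOnCl_const.sub ((Differentiable.diffContOnCl Q.differentiable).smul hH))
    ((Differentiable.diffContOnCl P.differentiable).smul hH)
    (fun z => mul_ne_zero (hP z) (hH0 z)) fun z => ?_
  have h1 : (P.eval (z : ℂ) * f z + Q.eval (z : ℂ)) * H z = 1 := by
    rw [hHG]
    exact mul_inv_cancel₀ (hne z)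
  rw [eq_div_iff (mul_ne_zero (hP z) (hH0 z))]
  linear_combination h1

theorem theorem1p1 (f : Circle → ℂ) (hf : Continuous f) :
    (ExtendsMeromorphically f ↔ ∃ N : ℕ, WindingBoundedBelow f N) ∧
    ∀ N : ℕ, WindingBoundedBelow f N →
      ∀ (A : Finset ℂ) (g : ℂ → ℂ), IsMeromorphicExtension f A g → poleCount A g ≤ (N : ℤ) := by
  refine ⟨⟨fun ⟨A, g, hg⟩ => ⟨(poleCount A g).toNat, hg.windingBoundedBelow (Int.self_le_toNat _)⟩,
    fun ⟨N, hN⟩ => hN.extendsMeromorphically hf⟩, fun N hN A g hg => hN.poleCount_le hf hg⟩
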